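/- **Theorem 3.3.** Let $K$ be a field and let $K\langle X\rangle=K\langle X_1,\dots,X_n\rangle$ be the free associative unital $K$-algebra, with standard $K$-basis $\mathcal B$ the set of all monomials (words) in $X_1,\dots,X_n$, including the empty word $1$. Assign to each $X_i$ a positive integer degree $m_i$; this makes $K\langle X\rangle=\bigoplus_{p\in\mathbb N}K\langle X\rangle_p$ an $\mathbb N$-graded algebra, where $K\langle X\rangle_p$ is spanned by the monomials of degree $p$. Write $d(u)$ for the degree of a monomial $u$. A *monomial ordering* on $\mathcal B$ is a well-ordering $\prec$ of $\mathcal B$ such that, for all $w,u,v,s\in\mathcal B$, $u\prec v$ implies $wus\prec wvs$, and $v=wus$ with $w\neq 1$ or $s\neq 1$ implies $u\prec v$. An *$\mathbb N$-graded monomial ordering* is a monomial ordering $\prec_{gr}$ for which there is a total ordering $\prec$ on $\mathcal B$ such that $$u\prec_{gr}v\iff d(u)<d(v),\ \text{ or }\ d(u)=d(v)\text{ and }u\prec v .$$ Fix such a $\prec_{gr}$. For $0\ne f\in K\langle X\rangle$ let $\mathbf{LM}(f)$ be the largest monomial, with respect to $\prec_{gr}$, occurring in $f$ with nonzero coefficient,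 and for $S\subseteq K\langle X\rangle$ put $\mathbf{LM}(S)=\{\mathbf{LM}(f)\mid 0\neq f\in S\}$. Ideals are two-sided, and $\langle U\rangle$ denotes the ideal generated by $U$. A *Gröbner basis* of an ideal $I$ is a subset $\mathcal G\subseteq I\setminus\{0\}$ with $\langle\mathbf{LM}(I)\rangle=\langle\mathbf{LM}(\mathcal G)\rangle$. Let $\mathcal G$ be a finite (not necessarily homogeneous) Gröbner basis of the ideal $I=\langle\mathcal G\rangle$ with respect to $\prec_{gr}$. Suppose that $\mathbf{LM}(\mathcal G)\cap\{X_1,\dots,X_n\}=\emptyset$ and that $\mathbf{LM}(\mathcal G)$ is reduced, i.e. for $v\neq u$ in $\mathbf{LM}(\mathcal G)$ there are no $w,s\in\mathcal B$ with $u=wvs$. Let $A=K\langle X\rangle/I$, filtered by $F_pA=\bigl(\bigoplus_{q\le p}K\langle X\rangle_q+I\bigr)/I$ for $p\in\mathbb N$, and let $$G(A)=\bigoplus_{p\in\mathbb N}F_pA/F_{<p}A,\qquad F_{<p}A=\bigcup_{q<p}F_qA\ \ (F_{<0}A=\{0\}),$$ be the associated graded algebra, with the multiplication induced by that of $A$.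 If the monomial algebra $\overline A=K\langle X\rangle/\langle\mathbf{LM}(\mathcal G)\rangle$ is semiprime (that is, $a\in\overline A$ and $a\overline Aa=\{0\}$ imply $a=0$), then $G(A)$ is semiprimitive, i.e. its Jacobson radical is zero. -/

import Mathlib

open scoped DirectSum

noncomputable section

namespace GradedGroebner

/-! ## Associated graded ring of an `ℕ`-filtered algebra -/

section AssociatedGraded

variable {K A : Type*} [CommRing K] [Ring A] [Algebra K A]

/-- The part `F_{<p} A` of an `ℕ`-indexed filtration: the join of all `F_q A` with `q < p`.
For an increasing filtration this is the union of the `F_q A`, `q < p`; for `p = 0` it is `0`. -/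
def ltPart (F : ℕ → Submodule K A) (p : ℕ) : Submodule K A := ⨆ q, ⨆ _ : q < p, F q

theorem ltPart_isRingFiltration (F : ℕ → Submodule K A) (hF : Monotone F)
    (h1 : (1 : A) ∈ F 0) (hm : ∀ p q x y, x ∈ F p → y ∈ F q → x * y ∈ F (p + q)) :
    IsRingFiltration F (ltPart F) where
  mono := hF
  is_le {i _} h := le_iSup₂_of_le i h le_rfl
  is_sup _ _ h := iSup₂_le h
  one_mem := h1
  mul_mem _ _ _ _ hx hy := hm _ _ _ _ hx hy

/-- The degree-`p` component `G(A)_p = F_p A / F_{<p} A`. -/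
def GrPiece (F : ℕ → Submodule K A) (p : ℕ) : Type _ :=
  (F p) ⧸ (ltPart F p).submoduleOf (F p)

instance (F : ℕ → Submodule K A) (p : ℕ) : AddCommGroup (GrPiece F p) :=
  inferInstanceAs (AddCommGroup ((F p) ⧸ (ltPart F p).submoduleOf (F p)))

instance (F : ℕ → Submodule K A) (p : ℕ) : Module K (GrPiece F p) :=
  inferInstanceAs (Module K ((F p) ⧸ (ltPart F p).submoduleOf (F p)))

variable (F : ℕ → Submodule K A)

/-- The class in `G(A)_p` of an element of `F_p A`. -/
def grMk {p : ℕ} (x : F p) : GrPiece F p := Submodule.Quotient.mk x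

theorem grMk_surjective {p : ℕ} (a : GrPiece F p) : ∃ x : F p, grMk F x = a :=
  Submodule.Quotient.mk_surjective _ a

theorem grMk_eq_iff {p : ℕ} (x y : F p) :
    grMk F x = grMk F y ↔ (x : A) - y ∈ ltPart F p := by
  exact Submodule.Quotient.eq _

theorem gr_ext {p q : ℕ} (h : p = q) (x : F p) (y : F q) (hxy : (x : A) = y) :
    GradedMonoid.mk (A := GrPiece F) p (grMk F x) = GradedMonoid.mk q (grMk F y) := by
  subst h
  rw [Subtype.ext hxy]

theorem mul_mem_ltPart_left [IsRingFiltration F (ltPart F)] {p q : ℕ} {x y : A}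
    (hx : x ∈ ltPart F p) (hy : y ∈ F q) : x * y ∈ ltPart F (p + q) := by
  have : ltPart F p ≤ (ltPart F (p + q)).comap (LinearMap.mulRight K y) := by
    refine iSup₂_le fun i hi z hz => ?_
    have h1 : z * y ∈ F (i + q) := SetLike.mul_mem_graded hz hy
    exact (IsFiltration.is_le (F := F) (F_lt := ltPart F) (by omega : i + q < p + q)) h1
  exact this hx

theorem mul_mem_ltPart_right [IsRingFiltration F (ltPart F)] {p q : ℕ} {x y : A}
    (hx : x ∈ F p) (hy : y ∈ ltPart F q) : x * y ∈ ltPart F (p + q) := by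
  have : ltPart F q ≤ (ltPart F (p + q)).comap (LinearMap.mulLeft K x) := by
    refine iSup₂_le fun i hi z hz => ?_
    have h1 : x * z ∈ F (p + i) := SetLike.mul_mem_graded hx hz
    exact (IsFiltration.is_le (F := F) (F_lt := ltPart F) (by omega : p + i < p + q)) h1
  exact this hy

/-- Multiplication `G(A)_p × G(A)_q → G(A)_{p+q}`, induced by the multiplication of `A`. -/
def grMul [IsRingFiltration F (ltPart F)] {p q : ℕ} (a : GrPiece F p) (b : GrPiece F q) :
    GrPiece F (p + q) :=
  Quotient.liftOn₂' a b
    (fun x y => grMk F (⟨(x : A) * y, SetLike.mul_mem_graded x.2 y.2⟩ : F (p + q)))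
    (by
      intro x y x' y' hx hy
      have hx' : (x : A) - x' ∈ ltPart F p := (grMk_eq_iff F x x').1 (Quotient.sound' hx)
      have hy' : (y : A) - y' ∈ ltPart F q := (grMk_eq_iff F y y').1 (Quotient.sound' hy)
      rw [grMk_eq_iff]
      have e : (x : A) * y - x' * y' = (x - x') * y + x' * (y - y') := by noncomm_ring
      rw [e]
      exact add_mem (mul_mem_ltPart_left F hx' y.2) (mul_mem_ltPart_right F x'.2 hy'))

theorem grMul_mk [IsRingFiltration F (ltPart F)] {p q : ℕ} (x : F p) (y : F q) :
    grMul F (grMk F x) (grMk F y) =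
      grMk F (⟨(x : A) * y, SetLike.mul_mem_graded x.2 y.2⟩ : F (p + q)) := rfl

theorem grMk_add {p : ℕ} (x y : F p) : grMk F (x + y) = grMk F x + grMk F y := rfl

theorem grMk_zero {p : ℕ} : grMk F (0 : F p) = 0 := rfl

/-- The graded multiplication, with unit the class of `1` in `G(A)_0`. -/
instance grGMonoid [IsRingFiltration F (ltPart F)] : GradedMonoid.GMonoid (GrPiece F) :=
  letI : GradedMonoid.GMul (GrPiece F) := ⟨fun a b => grMul F a b⟩
  letI : GradedMonoid.GOne (GrPiece F) := ⟨grMk F ⟨1, SetLike.GradedOne.one_mem⟩⟩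
  { one_mul := by
      rintro ⟨i, a⟩
      obtain ⟨x, rfl⟩ := grMk_surjective F a
      exact gr_ext F (zero_add i) _ _ (one_mul _)
    mul_one := by
      rintro ⟨i, a⟩
      obtain ⟨x, rfl⟩ := grMk_surjective F a
      exact gr_ext F (add_zero i) _ _ (mul_one _)
    mul_assoc := by
      rintro ⟨i, a⟩ ⟨j, b⟩ ⟨k, c⟩
      obtain ⟨x, rfl⟩ := grMk_surjective F a
      obtain ⟨y, rfl⟩ := grMk_surjective F b
      obtain ⟨z, rfl⟩ := grMk_surjective F c
      exact gr_ext F (add_assoc i j k) _ _ (mul_assoc _ _ _) }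

instance grGRing [IsRingFiltration F (ltPart F)] : DirectSum.GRing (GrPiece F) where
  toGMonoid := grGMonoid F
  mul_zero {i j} a := by
    obtain ⟨x, rfl⟩ := grMk_surjective F a
    rw [← grMk_zero F, ← grMk_zero F]
    exact congrArg _ (Subtype.ext (mul_zero _))
  zero_mul {i j} b := by
    obtain ⟨x, rfl⟩ := grMk_surjective F b
    rw [← grMk_zero F, ← grMk_zero F]
    exact congrArg _ (Subtype.ext (zero_mul _))
  mul_add {i j} a b c := by
    obtain ⟨x, rfl⟩ := grMk_surjective F a
    obtain ⟨y, rfl⟩ := grMk_surjective F b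
    obtain ⟨z, rfl⟩ := grMk_surjective F c
    simp only [← grMk_add]
    exact congrArg _ (Subtype.ext (mul_add _ _ _))
  add_mul {i j} a b c := by
    obtain ⟨x, rfl⟩ := grMk_surjective F a
    obtain ⟨y, rfl⟩ := grMk_surjective F b
    obtain ⟨z, rfl⟩ := grMk_surjective F c
    simp only [← grMk_add]
    exact congrArg _ (Subtype.ext (add_mul _ _ _))
  natCast n := n • grMk F ⟨1, SetLike.GradedOne.one_mem⟩
  natCast_zero := zero_smul _ _
  natCast_succ n := succ_nsmul _ n
  intCast n := n • grMk F ⟨1, SetLike.GradedOne.one_mem⟩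
  intCast_ofNat n := natCast_zsmul _ n
  intCast_negSucc_ofNat n := negSucc_zsmul _ n

/-- The associated graded ring `G(A) = ⨁_p F_p A / F_{<p} A`. -/
abbrev AssocGraded : Type _ := ⨁ p, GrPiece F p

end AssociatedGraded

/-! ## The free algebra, monomial orderings and Gröbner bases -/

/-- The monomials (words) in the variables `X_0, …, X_{n-1}`. -/
abbrev Word (n : ℕ) : Type := FreeMonoid (Fin n)

/-- The free algebra `K⟨X_0, …, X_{n-1}⟩`, realised as the monoid algebra of the words, which form
its standard basis (see `FreeAlgebra.equivMonoidAlgebraFreeMonoid`). -/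
abbrev FreeAlg (K : Type*) [Field K] (n : ℕ) : Type _ := MonoidAlgebra K (Word n)

/-- A word, regarded as an element of the free algebra. -/
abbrev mono (K : Type*) [Field K] {n : ℕ} (w : Word n) : FreeAlg K n := MonoidAlgebra.of K (Word n) w

/-- The degree of a word when `X_i` has degree `m i`. -/
def wdeg {n : ℕ} (m : Fin n → ℕ) (w : Word n) : ℕ := ((FreeMonoid.toList w).map m).sum

/-- `v` divides `u` as a word. -/
def WordDvd {n : ℕ} (v u : Word n) : Prop := ∃ w s : Word n, u = w * v * s

/-- A set of words is reduced if none of its members divides a different one. -/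
def IsReduced {n : ℕ} (Ω : Set (Word n)) : Prop :=
  ∀ v ∈ Ω, ∀ u ∈ Ω, v ≠ u → ¬ WordDvd v u

/-- A monomial ordering: a (strict) well-ordering of the words that is compatible with
multiplication on both sides and makes proper divisors smaller. -/
structure IsMonomialOrdering {n : ℕ} (lt : Word n → Word n → Prop) : Prop where
  wellOrder : IsWellOrder (Word n) lt
  mul_lt_mul : ∀ w u v s : Word n, lt u v → lt (w * u * s) (w * v * s)
  lt_of_dvd : ∀ w u v s : Word n, v = w * u * s → (w ≠ 1 ∨ s ≠ 1) → lt u v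

/-- The relation `≺_gr` obtained from `≺`: compare degrees first, break ties with `≺`. -/
def gradedRel {n : ℕ} (m : Fin n → ℕ) (lt : Word n → Word n → Prop) (u v : Word n) : Prop :=
  wdeg m u < wdeg m v ∨ (wdeg m u = wdeg m v ∧ lt u v)

/-- An `ℕ`-graded monomial ordering: a monomial ordering of the form `≺_gr` for some strict total
ordering `≺` of the words. -/
def IsGradedMonomialOrdering {n : ℕ} (m : Fin n → ℕ) (ltgr : Word n → Word n → Prop) : Prop :=
  IsMonomialOrdering ltgr ∧
    ∃ lt : Word n → Word n → Prop, IsStrictTotalOrder (Word n) lt ∧ ltgr = gradedRel m lt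

section

variable {K : Type*} [Field K] {n : ℕ}

/-- `w` is the leading monomial of `f`: the largest word occurring in `f`. (The zero element has no
leading monomial.) -/
def IsLM (lt : Word n → Word n → Prop) (f : FreeAlg K n) (w : Word n) : Prop :=
  f.coeff w ≠ 0 ∧ ∀ v, f.coeff v ≠ 0 → v ≠ w → lt v w

/-- The set `LM(S)` of leading monomials of the (nonzero) elements of `S`. -/
def LM (lt : Word n → Word n → Prop) (S : Set (FreeAlg K n)) : Set (Word n) :=
  {w | ∃ f ∈ S, IsLM lt f w}

/-- The monomial ideal generated by a set of words. -/
def monomialIdeal (K : Type*) [Field K] {n : ℕ} (Ω : Set (Word n)) : TwoSidedIdeal (FreeAlg K n) :=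
  TwoSidedIdeal.span (mono K '' Ω)

/-- `G` is a Gröbner basis of `I`: it consists of nonzero elements of `I`, and its leading monomials
generate the same ideal as the leading monomials of `I`. -/
def IsGroebnerBasis (lt : Word n → Word n → Prop) (G : Set (FreeAlg K n))
    (I : TwoSidedIdeal (FreeAlg K n)) : Prop :=
  G ⊆ (I : Set (FreeAlg K n)) \ {0} ∧
    monomialIdeal K (LM lt (I : Set (FreeAlg K n))) = monomialIdeal K (LM lt G)

/-- The degree-`p` homogeneous part of the free algebra for the weight `m`. -/
def homPart (K : Type*) [Field K] {n : ℕ} (m : Fin n → ℕ) (p : ℕ) : Submodule K (FreeAlg K n) :=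
  Submodule.span K (mono K '' {w | wdeg m w = p})

/-- The grading filtration `F_p K⟨X⟩ = ⨁_{q ≤ p} K⟨X⟩_q` of the free algebra. -/
def freeFiltration (K : Type*) [Field K] {n : ℕ} (m : Fin n → ℕ) (p : ℕ) :
    Submodule K (FreeAlg K n) := ⨆ q, ⨆ _ : q ≤ p, homPart K m q

/-- The quotient algebra `K⟨X⟩ / I`. -/
abbrev QuotAlg (I : TwoSidedIdeal (FreeAlg K n)) : Type _ := FreeAlg K n ⧸ I.asIdeal

/-- The filtration `F_p A = (F_p K⟨X⟩ + I) / I` of `A = K⟨X⟩ / I`. -/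
def quotFiltration (m : Fin n → ℕ) (I : TwoSidedIdeal (FreeAlg K n)) (p : ℕ) :
    Submodule K (QuotAlg I) :=
  (freeFiltration K m p).map (Ideal.Quotient.mkₐ K I.asIdeal).toLinearMap

theorem wdeg_mul (m : Fin n → ℕ) (u v : Word n) : wdeg m (u * v) = wdeg m u + wdeg m v := by
  simp [wdeg, FreeMonoid.toList_mul]

theorem homPart_mul_mem (m : Fin n → ℕ) (p q : ℕ) (x y : FreeAlg K n)
    (hx : x ∈ homPart K m p) (hy : y ∈ homPart K m q) : x * y ∈ homPart K m (p + q) := by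
  have h := Submodule.mul_mem_mul hx hy
  rw [homPart, homPart, Submodule.span_mul_span] at h
  refine Submodule.span_mono ?_ h
  rintro _ ⟨_, ⟨u, hu, rfl⟩, _, ⟨v, hv, rfl⟩, rfl⟩
  refine ⟨u * v, ?_, map_mul _ _ _⟩
  simp only [Set.mem_ofPred_eq] at hu hv ⊢
  rw [wdeg_mul, hu, hv]

theorem freeFiltration_mono (m : Fin n → ℕ) : Monotone (freeFiltration K m) := by
  intro p q h
  exact iSup₂_le fun i hi => le_iSup₂_of_le i (hi.trans h) le_rfl

theorem freeFiltration_mul_mem (m : Fin n → ℕ) (p q : ℕ) (x y : FreeAlg K n)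
    (hx : x ∈ freeFiltration K m p) (hy : y ∈ freeFiltration K m q) :
    x * y ∈ freeFiltration K m (p + q) := by
  have h := Submodule.mul_mem_mul hx hy
  refine (?_ : freeFiltration K m p * freeFiltration K m q ≤ _) h
  simp only [freeFiltration, Submodule.iSup_mul, Submodule.mul_iSup]
  refine iSup₂_le fun j hj => iSup₂_le fun i hi => le_iSup₂_of_le (i + j) (by omega) ?_
  exact Submodule.mul_le.2 fun a ha b hb => homPart_mul_mem m i j a b ha hb

instance quotFiltration_isRingFiltration (m : Fin n → ℕ) (I : TwoSidedIdeal (FreeAlg K n)) :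
    IsRingFiltration (quotFiltration m I) (ltPart (quotFiltration m I)) := by
  refine ltPart_isRingFiltration _ (fun p q h => Submodule.map_mono (freeFiltration_mono m h)) ?_ ?_
  · refine ⟨1, ?_, map_one (Ideal.Quotient.mkₐ K I.asIdeal)⟩
    refine (le_iSup₂_of_le (f := fun q (_ : q ≤ 0) => homPart K m q) 0 le_rfl le_rfl) ?_
    exact Submodule.subset_span ⟨1, rfl, rfl⟩
  · rintro p q _ _ ⟨x, hx, rfl⟩ ⟨y, hy, rfl⟩
    exact ⟨x * y, freeFiltration_mul_mem m p q x y hx hy,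
      map_mul (Ideal.Quotient.mkₐ K I.asIdeal) x y⟩

end

/-- A ring is semiprime if `a R a = 0` implies `a = 0`. -/
def IsSemiprimeRing (R : Type*) [Ring R] : Prop :=
  ∀ a : R, (∀ r : R, a * r * a = 0) → a = 0

/-- A ring is semiprimitive (in the sense of Jacobson) if its Jacobson radical is zero. -/
def IsSemiprimitiveRing (R : Type*) [Ring R] : Prop := Ring.jacobson R = ⊥

end GradedGroebner

end

noncomputable section

namespace GradedGroebner

/-! A word is normal if no leading monomial of `G` divides it. Because the ordering compares degrees
first, a homogeneous element with normal leading monomial has nonzero class in G(A)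
(`homClass_ne_zero`), and every homogeneous class has a representative supported on normal words
(`exists_homClass_eq`).

Suppose f lies in the Jacobson radical and f_j ≠ 0 with j > 0. Let u be the normal leading monomial
of such a representative x of f_j. Semiprimeness of the monomial algebra lets normal words recur,
and since `G` is finite this yields a word w with all powers (uw)^k normal
(`IsNormalWord.exists_pow_normal`). Then (xw)^k has leading monomial (uw)^k, so f_j w is not
nilpotent. In degree zero there are only scalars, and a nonzero scalar is a unit.

The contradiction comes from `isNilpotent_component_mul`, a weak form of Bergman's theorem that the
radical of a graded ring R is homogeneous. In the group ring R[t]/(t^q - 1), q a large prime, the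
maps r_i ↦ r_i t^(ki) preserve radical membership. Averaging them puts q(1 - t)f_j in the radical,
with no roots of unity needed. For a radical element z of positive degree d, 1 - zX^d has a
polynomial left inverse, so z is nilpotent. The factors q and 1 - t are then removed, as q(1 - t) is
a multiple of (1 - t)². -/

/-! ## Jacobson radical under finite centralizing extensions -/

/-- If `S` is generated, as a left module over `R`, by finitely many elements commuting with the
image of `R`, then `R → S` maps the Jacobson radical of `R` into that of `S`. -/
theorem map_mem_jacobson_of_centralizing {R S ι : Type*} [Ring R] [Ring S] [Finite ι]
    (φ : R →+* S) (e : ι → S) (hcomm : ∀ i r, Commute (e i) (φ r))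
    (hspan : ∀ s : S, ∃ c : ι → R, s = ∑ᶠ i, φ (c i) * e i) {f : R}
    (hf : f ∈ Ring.jacobson R) : φ f ∈ Ring.jacobson S := by
  classical
  have := Fintype.ofFinite ι
  simp only [finsum_eq_sum_of_fintype] at hspan
  let : Module R S := Module.compHom S φ
  have smul_def : ∀ (r : R) (s : S), r • s = φ r * s := fun _ _ => rfl
  rw [Ring.jacobson_eq_sInf_isMaximal, Submodule.mem_sInf]
  intro (𝔪 : Ideal S) (h𝔪 : 𝔪.IsMaximal)
  by_contra hnot
  let N : Submodule R S :=
    { carrier := 𝔪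
      add_mem' := 𝔪.add_mem
      zero_mem' := 𝔪.zero_mem
      smul_mem' := fun r s hs => 𝔪.mul_mem_left (φ r) hs }
  have hN : ∀ s, s ∈ N ↔ s ∈ 𝔪 := fun _ => Iff.rfl
  have hfin : Module.Finite R S := by
    refine Module.Finite.of_fg_top ⟨Finset.univ.image e, ?_⟩
    rw [eq_top_iff]
    intro s _
    obtain ⟨c, rfl⟩ := hspan s
    refine Submodule.sum_mem _ fun i _ => ?_
    rw [← smul_def]
    exact Submodule.smul_mem _ _ (Submodule.subset_span (by simp))
  have hnt : Nontrivial (S ⧸ N) := by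
    refine Submodule.Quotient.nontrivial_iff.2 fun h => h𝔪.ne_top ?_
    rw [Ideal.eq_top_iff_one, ← hN, h]
    exact Submodule.mem_top
  -- Nakayama: the finitely generated nonzero module S/𝔪 differs from J(R)·(S/𝔪). If 𝔪 missed φ f,
  -- then S = 𝔪 + S φ(f) would force equality.
  have hlt := Submodule.jacobson_smul_lt_top (R := R) (⊤ : Submodule R (S ⧸ N))
  refine hlt.ne (eq_top_iff.2 ?_)
  rintro x -
  obtain ⟨s, rfl⟩ := Submodule.Quotient.mk_surjective _ x
  have htop : 𝔪 ⊔ Ideal.span {φ f} = ⊤ := by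
    refine h𝔪.1.2 _ (lt_of_le_of_ne le_sup_left fun h => hnot ?_)
    rw [h]
    exact Ideal.mem_sup_right (Ideal.mem_span_singleton_self _)
  have hs : s ∈ 𝔪 ⊔ Ideal.span {φ f} := htop ▸ Submodule.mem_top
  obtain ⟨a, ha, b, hb, rfl⟩ := Submodule.mem_sup.1 hs
  obtain ⟨t, rfl⟩ := Ideal.mem_span_singleton'.1 hb
  obtain ⟨c, rfl⟩ := hspan t
  -- Commutation carries `f` past `e i` into the coefficient, which then lies in J(R).
  have e1 : (∑ i, φ (c i) * e i) * φ f = ∑ i, (c i * f) • e i := by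
    rw [Finset.sum_mul]
    refine Finset.sum_congr rfl fun i _ => ?_
    rw [smul_def, map_mul, mul_assoc, mul_assoc, (hcomm i f).eq]
  have e2 : (Submodule.Quotient.mk (a + (∑ i, φ (c i) * e i) * φ f) : S ⧸ N) =
      ∑ i, (c i * f) • Submodule.Quotient.mk (e i) := by
    rw [Submodule.Quotient.mk_add, (Submodule.Quotient.mk_eq_zero N).2 ha, zero_add, e1]
    exact map_sum N.mkQ _ _ |>.trans (by simp)
  rw [e2]
  exact Submodule.sum_mem _ fun i _ =>
    Submodule.smul_mem_smul (Ideal.mul_mem_left _ _ hf) Submodule.mem_top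

theorem exists_mul_one_sub_eq_one {R : Type*} [Ring R] {x : R} (hx : x ∈ Ring.jacobson R) :
    ∃ h : R, h * (1 - x) = 1 := by
  by_contra hno
  have hne : Ideal.span {1 - x} ≠ ⊤ := fun h =>
    hno (Ideal.mem_span_singleton'.1 ((Ideal.eq_top_iff_one _).1 h))
  obtain ⟨𝔪, h𝔪, hle⟩ := Ideal.exists_le_maximal _ hne
  refine h𝔪.ne_top ((Ideal.eq_top_iff_one _).2 ?_)
  have h1 : 1 - x ∈ 𝔪 := hle (Ideal.mem_span_singleton_self _)
  have h2 : x ∈ 𝔪 := Ring.jacobson_le_of_isMaximal 𝔪 hx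
  simpa using 𝔪.add_mem h1 h2

/-- If `1 - z X ^ d` has a left inverse in `S[X]` for some `d > 0`, then `z` is nilpotent. -/
theorem isNilpotent_of_mul_one_sub_monomial {S : Type*} [Ring S] {d : ℕ} (hd : 0 < d) {z : S}
    {P : Polynomial S} (hP : P * (1 - Polynomial.monomial d z) = 1) : IsNilpotent z := by
  have hrec : P = 1 + P * Polynomial.monomial d z := by
    rw [mul_sub, mul_one] at hP
    rw [← hP]
    abel
  -- The left inverse has to be the geometric series in zX^d, yet `P` has only finitely many
  -- coefficients.
  have hk : ∀ k, P.coeff (k * d) = z ^ k := by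
    intro k
    induction k with
    | zero =>
      rw [hrec]
      simp [Polynomial.mul_coeff_zero, Polynomial.coeff_monomial, hd.ne']
    | succ k ih =>
      rw [hrec, add_mul, one_mul, Polynomial.coeff_add, Polynomial.coeff_mul_monomial, ih,
        Polynomial.coeff_one, if_neg (by omega), zero_add, pow_succ]
  refine ⟨P.natDegree + 1, ?_⟩
  rw [← hk]
  refine Polynomial.coeff_eq_zero_of_natDegree_lt ?_
  nlinarith

/-! ## The Jacobson radical of an `ℕ`-graded ring

The group ring of a cyclic group of prime order `q` over a graded ring carries twists
`r_i ↦ r_i t ^ (k i)`; averaging over them isolates homogeneous components. -/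

section Graded

variable {A : ℕ → Type*} [∀ i, AddCommGroup (A i)] [DirectSum.GRing A]

variable (A) in
/-- The ring homomorphism `r_i ↦ r_i t ^ (k i)` into the group ring of `ZMod q`. -/
def twist (q : ℕ) (k : ZMod q) :
    (⨁ i, A i) →+* AddMonoidAlgebra (⨁ i, A i) (ZMod q) :=
  DirectSum.toSemiring
    (fun i => (AddMonoidAlgebra.singleAddHom (k * (i : ZMod q))).comp (DirectSum.of A i))
    (by simp [AddMonoidAlgebra.one_def]; rfl)
    (by
      intro i j a b
      simp [AddMonoidAlgebra.single_mul_single, mul_add, ← DirectSum.of_mul_of])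

theorem twist_of (q : ℕ) (k : ZMod q) (i : ℕ) (x : A i) :
    twist A q k (DirectSum.of A i x) =
      AddMonoidAlgebra.single (k * (i : ZMod q)) (DirectSum.of A i x) := by
  simp [twist]

theorem single_one_commute (q : ℕ) (j : ZMod q) (s : AddMonoidAlgebra (⨁ i, A i) (ZMod q)) :
    Commute (AddMonoidAlgebra.single j (1 : ⨁ i, A i)) s :=
  AddMonoidAlgebra.single_commute (fun _ => AddCommute.all _ _) (fun _ => Commute.one_left _) s

theorem twist_mem_jacobson (q : ℕ) [NeZero q] (k : ZMod q) {f : ⨁ i, A i}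
    (hf : f ∈ Ring.jacobson (⨁ i, A i)) :
    twist A q k f ∈ Ring.jacobson (AddMonoidAlgebra (⨁ i, A i) (ZMod q)) := by
  classical
  refine map_mem_jacobson_of_centralizing (twist A q k)
    (fun j : ZMod q => AddMonoidAlgebra.single j 1) (fun j r => single_one_commute q j _) ?_ hf
  simp only [finsum_eq_sum_of_fintype]
  intro s
  induction s using AddMonoidAlgebra.induction_linear with
  | zero => exact ⟨0, by simp⟩
  | add s t hs ht =>
    obtain ⟨c, rfl⟩ := hs
    obtain ⟨d, rfl⟩ := ht
    exact ⟨c + d, by simp [add_mul, Finset.sum_add_distrib]⟩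
  | single j r =>
    induction r using DirectSum.induction_on with
    | zero => exact ⟨0, by simp⟩
    | add r r' hr hr' =>
      obtain ⟨c, hc⟩ := hr
      obtain ⟨d, hd⟩ := hr'
      exact ⟨c + d, by simp [add_mul, Finset.sum_add_distrib, hc, hd, AddMonoidAlgebra.single_add]⟩
    | of i x =>
      -- The twist already contributes t^(ki), so t^(j - ki) is what remains to reach t^j.
      refine ⟨Pi.single (j - k * i) (DirectSum.of A i x), ?_⟩
      rw [Finset.sum_eq_single (j - k * (i : ZMod q))]
      · rw [Pi.single_eq_same, twist_of, AddMonoidAlgebra.single_mul_single]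
        simp
      · intro b _ hb
        rw [Pi.single_eq_of_ne hb, map_zero, zero_mul]
      · simp

variable (A) in
/-- The element `1 - t` of the group ring of `ZMod q`. -/
def oneSubT (q : ℕ) :
    AddMonoidAlgebra (⨁ i, A i) (ZMod q) := 1 - AddMonoidAlgebra.single 1 1

theorem oneSubT_commute (q : ℕ) (s : AddMonoidAlgebra (⨁ i, A i) (ZMod q)) :
    Commute (oneSubT A q) s :=
  (Commute.one_left s).sub_left (single_one_commute q 1 s)

theorem oneSubT_mul_sum (q : ℕ) [NeZero q] (r : ⨁ i, A i) :
    oneSubT A q * ∑ k : ZMod q, AddMonoidAlgebra.single k r = 0 := by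
  rw [oneSubT, sub_mul, one_mul, Finset.mul_sum, sub_eq_zero]
  simp only [AddMonoidAlgebra.single_mul_single, one_mul]
  exact (Equiv.sum_comp (Equiv.addLeft (1 : ZMod q))
    (fun k => AddMonoidAlgebra.single k r)).symm

theorem oneSubT_mul_average_of (q : ℕ) [Fact q.Prime] (i j : ℕ) (x : A i) :
    oneSubT A q * ∑ k : ZMod q, AddMonoidAlgebra.single (-(k * (j : ZMod q))) 1 *
        twist A q k (DirectSum.of A i x) =
      if (i : ZMod q) = j then
        oneSubT A q * (q • AddMonoidAlgebra.single 0 (DirectSum.of A i x)) else 0 := by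
  simp only [twist_of, AddMonoidAlgebra.single_mul_single, one_mul]
  split_ifs with h
  · simp [h, ZMod.card]
  · have h' : (i : ZMod q) - j ≠ 0 := sub_ne_zero.2 h
    -- As i - j is a unit mod the prime q, k ↦ k(i - j) permutes the exponents: the average is the
    -- full sum of powers of t, which 1 - t kills.
    rw [← oneSubT_mul_sum q (DirectSum.of A i x)]
    congr 1
    refine Fintype.sum_equiv (Equiv.mulRight₀ _ h') _ _ fun k => ?_
    simp only [Equiv.mulRight₀_apply]
    congr 1
    ring

/-- A weak form of homogeneity of the Jacobson radical. -/
theorem oneSubT_mul_component_mem_jacobson (q : ℕ) [Fact q.Prime] {f : ⨁ i, A i}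
    (hf : f ∈ Ring.jacobson (⨁ i, A i)) (hq : ∀ i, f i ≠ 0 → i < q) {j : ℕ} (hj : f j ≠ 0) :
    oneSubT A q * (q • AddMonoidAlgebra.single 0 (DirectSum.of A j (f j))) ∈
      Ring.jacobson (AddMonoidAlgebra (⨁ i, A i) (ZMod q)) := by
  classical
  have h1 : oneSubT A q * ∑ k : ZMod q, AddMonoidAlgebra.single (-(k * (j : ZMod q))) 1 *
      twist A q k f ∈ Ring.jacobson (AddMonoidAlgebra (⨁ i, A i) (ZMod q)) :=
    Ideal.mul_mem_left _ _ (Ideal.sum_mem _ fun k _ =>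
      Ideal.mul_mem_left _ _ (twist_mem_jacobson q k hf))
  convert! h1 using 1
  conv_rhs => rw [← DirectSum.sum_support_of f]
  simp only [map_sum, Finset.mul_sum]
  rw [Finset.sum_comm]
  simp only [← Finset.mul_sum, oneSubT_mul_average_of]
  rw [Finset.sum_eq_single j]
  · simp
  · intro i hi hij
    refine if_neg fun h => hij ?_
    have hi' := hq i (DFinsupp.mem_support_iff.1 hi)
    have := (ZMod.natCast_eq_natCast_iff' i j q).1 h
    rwa [Nat.mod_eq_of_lt hi', Nat.mod_eq_of_lt (hq j hj)] at this
  · intro h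
    exact absurd hj (by simpa using h)

variable (A) in
/-- The grading of `R` extended to the group ring of `ZMod q`, as a homomorphism `r_i ↦ r_i X ^ i`
into the polynomial ring. -/
def gradingHom (q : ℕ) :
    AddMonoidAlgebra (⨁ i, A i) (ZMod q) →+*
      Polynomial (AddMonoidAlgebra (⨁ i, A i) (ZMod q)) :=
  AddMonoidAlgebra.liftNCRingHom
    (DirectSum.toSemiring
      (fun i => ((Polynomial.monomial i).toAddMonoidHom.comp
        (AddMonoidAlgebra.singleAddHom (0 : ZMod q))).comp (DirectSum.of A i))
      (by
        change Polynomial.monomial 0 (1 : AddMonoidAlgebra (⨁ i, A i) (ZMod q)) = 1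
        simp)
      (by
        intro i j a b
        simp [Polynomial.monomial_mul_monomial, AddMonoidAlgebra.single_mul_single,
          ← DirectSum.of_mul_of]))
    ((Polynomial.C : _ →+* Polynomial (AddMonoidAlgebra (⨁ i, A i) (ZMod q))).toMonoidHom.comp
      (AddMonoidAlgebra.of (⨁ i, A i) (ZMod q)))
    (by
      intro r k
      induction r using DirectSum.induction_on with
      | zero => rw [map_zero]; exact Commute.zero_left _
      | add r r' hr hr' => rw [map_add]; exact hr.add_left hr'
      | of i x =>
        rw [DirectSum.toSemiring_of]
        change Polynomial.monomial i (AddMonoidAlgebra.single 0 (DirectSum.of A i x)) *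
          Polynomial.C (AddMonoidAlgebra.single k.toAdd 1) =
          Polynomial.C (AddMonoidAlgebra.single k.toAdd 1) * Polynomial.monomial i _
        rw [Polynomial.monomial_mul_C, Polynomial.C_mul_monomial,
          (single_one_commute q _ _).eq]
        rfl)

theorem gradingHom_single_of (q : ℕ) (k : ZMod q) (i : ℕ) (x : A i) :
    gradingHom A q (AddMonoidAlgebra.single k (DirectSum.of A i x)) =
      Polynomial.monomial i (AddMonoidAlgebra.single k (DirectSum.of A i x)) := by
  rw [gradingHom, AddMonoidAlgebra.liftNCRingHom_single, DirectSum.toSemiring_of]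
  change Polynomial.monomial i (AddMonoidAlgebra.single 0 (DirectSum.of A i x)) *
    Polynomial.C (AddMonoidAlgebra.single k 1) = _
  rw [Polynomial.monomial_mul_C, AddMonoidAlgebra.single_mul_single, zero_add, mul_one]

/-- With t placed in degree zero, (1 - t)y for homogeneous y maps to a single monomial, as
`isNilpotent_of_mul_one_sub_monomial` requires. -/
theorem gradingHom_oneSubT (q : ℕ) :
    gradingHom A q (oneSubT A q) = Polynomial.C (oneSubT A q) := by
  rw [oneSubT, map_sub, map_one, map_sub, map_one]
  congr 1
  exact gradingHom_single_of q 1 0 1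

/-- A constant annihilated by a power of `1 - t` is annihilated by a power of `q`. -/
theorem smul_pow_eq_zero_of_oneSubT_pow_mul (q : ℕ) [Fact q.Prime] (r : ⨁ i, A i) (k : ℕ)
    (h : oneSubT A q ^ (k + 1) * AddMonoidAlgebra.single 0 r = 0) : q ^ k • r = 0 := by
  classical
  -- The coefficient of (1 - t)r at t^0 is r, since 1 ≠ 0 in `ZMod q`.
  have hconst : ∀ r : ⨁ i, A i, oneSubT A q * AddMonoidAlgebra.single 0 r = 0 → r = 0 := by
    intro r hr
    have h0 := congrArg (fun s => s.coeff 0) hr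
    simpa [oneSubT, sub_mul, AddMonoidAlgebra.single_mul_single, Finsupp.single_apply] using h0
  induction k generalizing r with
  | zero => simpa using hconst r (by simpa using h)
  | succ k ih =>
    -- q - Σ t^k = Σ (1 - t^k), and each summand is divisible by 1 - t. Multiplying by 1 - t kills Σ
    -- t^k, so one factor q can be traded for one factor 1 - t.
    have hdvd : ∃ Q, (q : AddMonoidAlgebra (⨁ i, A i) (ZMod q)) =
        (∑ k : ZMod q, AddMonoidAlgebra.single k 1) + Q * oneSubT A q := by
      have hex : ∀ k : ℕ, ∃ Q, (1 : AddMonoidAlgebra (⨁ i, A i) (ZMod q)) =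
          AddMonoidAlgebra.single (k : ZMod q) 1 + Q * oneSubT A q := by
        intro k
        induction k with
        | zero => exact ⟨0, by simp [AddMonoidAlgebra.one_def]⟩
        | succ k ih =>
          obtain ⟨Q, hQ⟩ := ih
          refine ⟨Q + AddMonoidAlgebra.single (k : ZMod q) 1, ?_⟩
          rw [add_mul, oneSubT, mul_sub (AddMonoidAlgebra.single (k : ZMod q) 1), mul_one,
            AddMonoidAlgebra.single_mul_single, ← oneSubT, mul_one]
          nth_rw 1 [hQ]
          push_cast
          abel
      choose Q hQ using hex
      refine ⟨∑ k : ZMod q, Q k.val, ?_⟩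
      rw [Finset.sum_mul, ← Finset.sum_add_distrib]
      have : ∀ k : ZMod q, AddMonoidAlgebra.single k 1 + Q k.val * oneSubT A q = 1 := by
        intro k
        conv_rhs => rw [hQ k.val, ZMod.natCast_zmod_val]
      simp [this, ZMod.card]
    obtain ⟨Q, hQ⟩ := hdvd
    have hq : oneSubT A q * (q : AddMonoidAlgebra (⨁ i, A i) (ZMod q)) =
        Q * oneSubT A q ^ 2 := by
      rw [hQ, mul_add, oneSubT_mul_sum, zero_add, ← mul_assoc, (oneSubT_commute q Q).eq,
        mul_assoc, pow_two]
    have hs : AddMonoidAlgebra.single (0 : ZMod q) (q • r) =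
        (q : AddMonoidAlgebra (⨁ i, A i) (ZMod q)) * AddMonoidAlgebra.single 0 r := by
      rw [← nsmul_eq_mul]
      exact map_nsmul (AddMonoidAlgebra.singleAddHom (0 : ZMod q)) q r
    rw [pow_succ, mul_smul]
    refine ih (q • r) ?_
    rw [hs, ← mul_assoc, pow_succ, mul_assoc _ (oneSubT A q), hq, ← mul_assoc,
      ((oneSubT_commute q Q).pow_left k).eq, mul_assoc, mul_assoc, ← mul_assoc (_ ^ k), ← pow_add,
      show k + 2 = k + 1 + 1 from rfl, h, mul_zero]

/-- If the Jacobson radical of an `ℕ`-graded ring contains `f`, then every element of positive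
degree of the form `f_j w`, `w` homogeneous, is nilpotent, if there are enough primes that are not
zero divisors. -/
theorem isNilpotent_component_mul {f : ⨁ i, A i} (hf : f ∈ Ring.jacobson (⨁ i, A i))
    (htors : ∀ N : ℕ, ∃ q > N, q.Prime ∧ ∀ r : ⨁ i, A i, q • r = 0 → r = 0) {j l : ℕ}
    (hjl : 0 < j + l) (w : A l) :
    IsNilpotent (DirectSum.of A j (f j) * DirectSum.of A l w) := by
  classical
  by_cases hj : f j = 0
  · simp [hj]
  obtain ⟨q, hqN, hqp, hqt⟩ := htors (f.support.sup id)
  have : Fact q.Prime := ⟨hqp⟩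
  have hmem := oneSubT_mul_component_mem_jacobson q hf
    (fun i hi => (Finset.le_sup (f := id) (DFinsupp.mem_support_iff.2 hi)).trans_lt hqN) hj
  have hmem' := Ideal.IsTwoSided.mul_mem_of_left (I := Ring.jacobson _)
    (AddMonoidAlgebra.single (0 : ZMod q) (DirectSum.of A l w)) hmem
  rw [mul_assoc, smul_mul_assoc, AddMonoidAlgebra.single_mul_single, zero_add, DirectSum.of_mul_of] at hmem'
  rw [DirectSum.of_mul_of]
  set y := GradedMonoid.GMul.mul (f j) w
  obtain ⟨h, hh⟩ := exists_mul_one_sub_eq_one hmem'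
  have hP := congrArg (gradingHom A q) hh
  rw [map_mul, map_sub, map_one, map_mul, gradingHom_oneSubT, map_nsmul, gradingHom_single_of,
    ← map_nsmul (Polynomial.monomial (j + l)), Polynomial.C_mul_monomial] at hP
  obtain ⟨k, hk⟩ := isNilpotent_of_mul_one_sub_monomial hjl hP
  -- The exponent k + 1 is the form in which powers of 1 - t are removed. That costs q^k, on top of
  -- the q^(k+1) already present.
  have hk' := pow_eq_zero_of_le (Nat.le_succ k) hk
  rw [(oneSubT_commute q _).mul_pow, smul_pow, AddMonoidAlgebra.single_pow, smul_zero,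
    AddMonoidAlgebra.smul_single] at hk'
  have h0 := smul_pow_eq_zero_of_oneSubT_pow_mul q _ k hk'
  rw [smul_smul] at h0
  have hpow : ∀ (a : ℕ) (r : ⨁ i, A i), q ^ a • r = 0 → r = 0 := by
    intro a
    induction a with
    | zero => simp
    | succ a ih => exact fun r hr => hqt r (ih _ (by rwa [smul_smul, ← pow_succ]))
  exact ⟨k + 1, hpow (k + (k + 1)) _ (by rwa [pow_add])⟩

end Graded

/-! ## Normal words -/

section Words

variable {n : ℕ}

/-- A word is normal modulo `Ω` if no member of `Ω` divides it. -/
def IsNormalWord (Ω : Set (Word n)) (u : Word n) : Prop := ∀ ω ∈ Ω, ¬ WordDvd ω u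

theorem WordDvd.mul {v u : Word n} (h : WordDvd v u) (a b : Word n) : WordDvd v (a * u * b) := by
  obtain ⟨w, s, rfl⟩ := h
  exact ⟨a * w, s * b, by simp only [mul_assoc]⟩

theorem WordDvd.mul_left {v u : Word n} (h : WordDvd v u) (a : Word n) : WordDvd v (a * u) := by
  simpa using h.mul a 1

theorem WordDvd.mul_right {v u : Word n} (h : WordDvd v u) (b : Word n) : WordDvd v (u * b) := by
  simpa using h.mul 1 b

theorem IsNormalWord.of_mul_left {Ω : Set (Word n)} {u v : Word n} (h : IsNormalWord Ω (u * v)) :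
    IsNormalWord Ω u := fun ω hω hd => h ω hω (hd.mul_right v)

/-- Two normal words overlapping in a word that is at least as long as every member of `Ω` can be
glued along the overlap. -/
theorem IsNormalWord.glue {Ω : Set (Word n)} {a p b : Word n} (h1 : IsNormalWord Ω (a * p))
    (h2 : IsNormalWord Ω (p * b)) (hp : ∀ ω ∈ Ω, ω.length ≤ p.length) :
    IsNormalWord Ω (a * p * b) := by
  rintro ω hω ⟨w, s, hws⟩
  have hlen : (FreeMonoid.toList ω).length ≤ (FreeMonoid.toList p).length := hp ω hω
  have hws' : (a.toList ++ p.toList) ++ b.toList = (w.toList ++ ω.toList) ++ s.toList := by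
    simpa only [FreeMonoid.toList_mul] using congrArg FreeMonoid.toList hws
  -- Either `ω` ends at or beyond the end of `p`, and being no longer than `p` it lies inside `p *
  -- b`, or it lies inside `a * p`.
  rcases List.append_eq_append_iff.1 hws' with ⟨c, hc, hb⟩ | ⟨c, hc, -⟩
  · rw [eq_comm, List.append_assoc] at hc
    have hbs : p.toList ++ b.toList = (p.toList ++ c) ++ s.toList := by
      rw [hb, List.append_assoc]
    have hdiv : ∃ d, p.toList ++ c = d ++ ω.toList := by
      rcases List.append_eq_append_iff.1 hc with ⟨d, hd, hd'⟩ | ⟨d, hd, hd'⟩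
      · exact ⟨d, hd'⟩
      · refine ⟨[], ?_⟩
        have hl := congrArg List.length hd'
        simp only [List.length_append] at hl
        have hd0 : d = [] := List.length_eq_zero_iff.1 (by omega)
        rw [hd', hd0]
        rfl
    obtain ⟨d, hd⟩ := hdiv
    refine h2 ω hω ⟨FreeMonoid.ofList d, s, ?_⟩
    apply FreeMonoid.toList.injective
    simp only [FreeMonoid.toList_mul, FreeMonoid.toList_ofList]
    rw [hbs, hd]
  · refine h1 ω hω ⟨w, FreeMonoid.ofList c, ?_⟩
    apply FreeMonoid.toList.injective
    simp only [FreeMonoid.toList_mul, FreeMonoid.toList_ofList]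
    exact hc

/-- If every normal word `u` has a normal multiple `u v u` and the lengths of the members of `Ω` are
bounded, then every nonempty normal word is an initial segment of a period of an infinite periodic
normal word. -/
theorem IsNormalWord.exists_pow_normal {Ω : Set (Word n)} {N : ℕ} (hN : ∀ ω ∈ Ω, ω.length ≤ N)
    (hrec : ∀ u, IsNormalWord Ω u → ∃ v, IsNormalWord Ω (u * v * u)) {u : Word n}
    (hu : IsNormalWord Ω u) (hu1 : 1 ≤ u.length) :
    ∃ w, ∀ k, IsNormalWord Ω ((u * w) ^ k) := by
  -- Recurrence first prolongs `u` to a normal word p of length at least `N`. With p v p normal,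
  -- gluing along copies of p gives (p v)^k p.
  have hext : ∀ L, ∃ x, IsNormalWord Ω (u * x) ∧ L ≤ (u * x).length := by
    intro L
    induction L with
    | zero => exact ⟨1, by simpa using hu, Nat.zero_le _⟩
    | succ L ih =>
      obtain ⟨x, hx, hL⟩ := ih
      obtain ⟨v, hv⟩ := hrec _ hx
      refine ⟨x * v * (u * x), by simpa only [mul_assoc] using hv, ?_⟩
      simp only [FreeMonoid.length_mul] at hL ⊢
      omega
  obtain ⟨x, hx, hL⟩ := hext N
  obtain ⟨v, hv⟩ := hrec _ hx
  refine ⟨x * v, fun k => ?_⟩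
  have hk : ∀ k, IsNormalWord Ω ((u * x * v) ^ k * (u * x)) := by
    intro k
    induction k with
    | zero => simpa using hx
    | succ k ih =>
      have := ih.glue (b := v * (u * x)) (by simpa only [mul_assoc] using hv)
        fun ω hω => (hN ω hω).trans hL
      simpa only [pow_succ, mul_assoc] using this
  rw [← mul_assoc]
  exact (hk k).of_mul_left

end Words

/-! ## Supports, monomial ideals and leading monomials -/

section FreeAlgebra

variable {K : Type*} [Field K] {n : ℕ}

theorem coeff_mono (v w : Word n) [Decidable (v = w)] :
    (mono K v).coeff w = if v = w then 1 else 0 := by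
  classical
  simp only [MonoidAlgebra.of_apply, MonoidAlgebra.coeff_single, Finsupp.single_apply]

theorem mem_span_mono {s : Set (Word n)} {f : FreeAlg K n} :
    f ∈ Submodule.span K (mono K '' s) ↔ ∀ w, f.coeff w ≠ 0 → w ∈ s := by
  classical
  constructor
  · intro h
    induction h using Submodule.span_induction with
    | mem x hx =>
      obtain ⟨v, hv, rfl⟩ := hx
      intro w hw
      rw [coeff_mono] at hw
      rwa [← (ite_ne_right_iff.1 hw).1]
    | zero => simp
    | add x y _ _ hx hy =>
      intro w hw
      by_cases h : x.coeff w = 0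
      · exact hy w (by simpa [h] using hw)
      · exact hx w h
    | smul c x _ hx =>
      intro w hw
      exact hx w (by simp at hw; tauto)
  · intro h
    rw [← MonoidAlgebra.sum_coeff_single f]
    refine Submodule.sum_mem _ fun w hw => ?_
    have : MonoidAlgebra.single w (f.coeff w) = f.coeff w • mono K w := by
      simp [MonoidAlgebra.of_apply, MonoidAlgebra.smul_single]
    rw [this]
    exact Submodule.smul_mem _ _ (Submodule.subset_span ⟨w, h w (Finsupp.mem_support_iff.1 hw), rfl⟩)

theorem coeff_mul_ne_zero {f g : FreeAlg K n} {w : Word n} (h : (f * g).coeff w ≠ 0) :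
    ∃ a b, f.coeff a ≠ 0 ∧ g.coeff b ≠ 0 ∧ a * b = w := by
  classical
  by_contra! hno
  refine h ?_
  rw [MonoidAlgebra.coeff_mul]
  refine Finset.sum_eq_zero fun a ha => Finset.sum_eq_zero fun b hb => ?_
  exact if_neg (hno a b (Finsupp.mem_support_iff.1 ha) (Finsupp.mem_support_iff.1 hb))

/-- All words occurring in an element of a monomial ideal are divisible by a generator. -/
theorem exists_wordDvd_of_mem_monomialIdeal {Ω : Set (Word n)} {f : FreeAlg K n}
    (hf : f ∈ monomialIdeal K Ω) {w : Word n} (hw : f.coeff w ≠ 0) : ∃ ω ∈ Ω, WordDvd ω w := by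
  classical
  let J : TwoSidedIdeal (FreeAlg K n) := TwoSidedIdeal.mk'
    {f | ∀ w, f.coeff w ≠ 0 → ∃ ω ∈ Ω, WordDvd ω w}
    (fun w hw => by simp at hw)
    (fun {x y} hx hy w hw => by
      by_cases h : x.coeff w = 0
      · exact hy w (by simpa [h] using hw)
      · exact hx w h)
    (fun {x} hx w hw => hx w (by simpa using hw))
    (fun {x y} hy w hw => by
      obtain ⟨a, b, -, hb, rfl⟩ := coeff_mul_ne_zero hw
      obtain ⟨ω, hω, hd⟩ := hy b hb
      exact ⟨ω, hω, hd.mul_left a⟩)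
    (fun {x y} hx w hw => by
      obtain ⟨a, b, ha, -, rfl⟩ := coeff_mul_ne_zero hw
      obtain ⟨ω, hω, hd⟩ := hx a ha
      exact ⟨ω, hω, hd.mul_right b⟩)
  have hle : monomialIdeal K Ω ≤ J := by
    refine TwoSidedIdeal.span_le.2 ?_
    rintro _ ⟨ω, hω, rfl⟩
    rw [SetLike.mem_coe, TwoSidedIdeal.mem_mk']
    intro w hw
    rw [coeff_mono] at hw
    exact ⟨ω, hω, 1, 1, by simp [(ite_ne_right_iff.1 hw).1]⟩
  have := hle hf
  rw [TwoSidedIdeal.mem_mk'] at this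
  exact this w hw

theorem mono_mem_monomialIdeal {Ω : Set (Word n)} {ω u : Word n} (hω : ω ∈ Ω)
    (h : WordDvd ω u) : mono K u ∈ monomialIdeal K Ω := by
  obtain ⟨w, s, rfl⟩ := h
  rw [mono, map_mul, map_mul]
  exact TwoSidedIdeal.mul_mem_right _ _ _
    (TwoSidedIdeal.mul_mem_left _ _ _ (TwoSidedIdeal.subset_span ⟨ω, hω, rfl⟩))

/-- In a semiprime monomial algebra every nonzero word `u` has a nonzero multiple `u v u`. -/
theorem exists_normal_mul_mul_of_semiprime {Ω : Set (Word n)}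
    (hsp : IsSemiprimeRing (QuotAlg (monomialIdeal K Ω))) {u : Word n}
    (hu : IsNormalWord Ω u) : ∃ v, IsNormalWord Ω (u * v * u) := by
  classical
  by_contra! hno
  -- If all words u v u vanish in the monomial algebra, linearity gives u r u = 0 for every r, so
  -- semiprimeness kills u.
  have hmem : mono K u ∈ monomialIdeal K Ω := by
    rw [← TwoSidedIdeal.mem_asIdeal, ← Ideal.Quotient.eq_zero_iff_mem]
    refine hsp _ fun r => ?_
    obtain ⟨f, rfl⟩ := Ideal.Quotient.mk_surjective r
    rw [← map_mul, ← map_mul, Ideal.Quotient.eq_zero_iff_mem, TwoSidedIdeal.mem_asIdeal]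
    induction f using MonoidAlgebra.induction_on with
    | of v =>
      have := hno v
      simp only [IsNormalWord, not_forall, not_not] at this
      obtain ⟨ω, hω, hd⟩ := this
      rw [← map_mul, ← map_mul]
      exact mono_mem_monomialIdeal hω hd
    | add f g hf hg =>
      rw [mul_add, add_mul]
      exact TwoSidedIdeal.add_mem _ hf hg
    | smul c f hf =>
      rw [mul_smul_comm, smul_mul_assoc, Algebra.smul_def]
      exact TwoSidedIdeal.mul_mem_left _ _ _ hf
  obtain ⟨ω, hω, hd⟩ := exists_wordDvd_of_mem_monomialIdeal hmem (w := u) (by simp)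
  exact hu ω hω hd

variable {lt : Word n → Word n → Prop}

theorem isLM_mono (v : Word n) : IsLM lt (mono K v) v := by
  classical
  refine ⟨by simp, fun w hw hwv => ?_⟩
  rw [coeff_mono] at hw
  exact absurd (ite_ne_right_iff.1 hw).1.symm hwv

/-- By strict monotonicity on both sides, `u * v` arises only from the pair (u, v), so its
coefficient is a product of two nonzero scalars. -/
theorem IsLM.mul (hlt : IsMonomialOrdering lt) {f g : FreeAlg K n} {u v : Word n}
    (hf : IsLM lt f u) (hg : IsLM lt g v) : IsLM lt (f * g) (u * v) := by
  have := hlt.wellOrder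
  have key : ∀ a b, f.coeff a ≠ 0 → g.coeff b ≠ 0 → (a = u ∧ b = v) ∨ lt (a * b) (u * v) := by
    intro a b ha hb
    by_cases h1 : a = u
    · by_cases h2 : b = v
      · exact Or.inl ⟨h1, h2⟩
      · right
        rw [h1]
        simpa using hlt.mul_lt_mul u b v 1 (hg.2 b hb h2)
    · right
      have h3 : lt (a * b) (u * b) := by simpa using hlt.mul_lt_mul 1 a u b (hf.2 a ha h1)
      by_cases h2 : b = v
      · rwa [h2] at h3 ⊢
      · exact _root_.trans h3 (by simpa using hlt.mul_lt_mul u b v 1 (hg.2 b hb h2))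
  constructor
  · rw [MonoidAlgebra.coeff_mul_mul_of_uniqueMul]
    · exact mul_ne_zero hf.1 hg.1
    · intro a b ha hb hab
      rcases key a b (Finsupp.mem_support_iff.1 ha) (Finsupp.mem_support_iff.1 hb) with h | h
      · exact h
      · rw [hab] at h
        exact absurd h (irrefl _)
  · intro w hw hne
    obtain ⟨a, b, ha, hb, rfl⟩ := coeff_mul_ne_zero hw
    rcases key a b ha hb with ⟨rfl, rfl⟩ | h
    · exact absurd rfl hne
    · exact h

theorem IsLM.pow (hlt : IsMonomialOrdering lt) {f : FreeAlg K n} {u : Word n}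
    (hf : IsLM lt f u) (k : ℕ) : IsLM lt (f ^ k) (u ^ k) := by
  induction k with
  | zero => simpa only [pow_zero, map_one] using isLM_mono (K := K) (lt := lt) (1 : Word n)
  | succ k ih =>
    rw [pow_succ, pow_succ]
    exact ih.mul hlt hf

theorem exists_isLM (hlt : IsMonomialOrdering lt) {f : FreeAlg K n} (hf : f ≠ 0) :
    ∃ u, IsLM lt f u := by
  classical
  have := hlt.wellOrder
  let : LinearOrder (Word n) := linearOrderOfSTO lt
  have hne : f.coeff.support.Nonempty := by
    rw [Finsupp.support_nonempty_iff]
    simpa using hf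
  refine ⟨f.coeff.support.max' hne,
    Finsupp.mem_support_iff.1 (Finset.max'_mem _ hne), fun v hv hvu => ?_⟩
  exact lt_of_le_of_ne (Finset.le_max' _ v (Finsupp.mem_support_iff.2 hv)) hvu

/-- One step of the division algorithm: the rescaled `f` cancels `v` and leaves smaller words. -/
theorem IsLM.mono_sub_smul_mem {f : FreeAlg K n} {v : Word n} (hf : IsLM lt f v) :
    mono K v - (f.coeff v)⁻¹ • f ∈ Submodule.span K (mono K '' {w | lt w v}) := by
  classical
  rw [mem_span_mono]
  intro w hw
  by_cases hwv : v = w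
  · subst hwv
    refine absurd ?_ hw
    simp [inv_mul_cancel₀ hf.1]
  · refine hf.2 w (fun h => hw ?_) (Ne.symm hwv)
    rw [MonoidAlgebra.coeff_sub, Finsupp.sub_apply, coeff_mono, if_neg hwv,
      MonoidAlgebra.coeff_smul_apply, h, smul_zero, sub_zero]

variable {G : Set (FreeAlg K n)}

/-- The leading monomial of an element of an ideal is not normal modulo a Gröbner basis. -/
theorem IsGroebnerBasis.not_isNormalWord {I : TwoSidedIdeal (FreeAlg K n)}
    (hG : IsGroebnerBasis lt G I) {f : FreeAlg K n} (hf : f ∈ I) {u : Word n} (hu : IsLM lt f u) :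
    ¬ IsNormalWord (LM lt G) u := by
  intro hn
  have h1 : mono K u ∈ monomialIdeal K (LM lt (I : Set (FreeAlg K n))) :=
    TwoSidedIdeal.subset_span ⟨u, ⟨f, hf, hu⟩, rfl⟩
  rw [hG.2] at h1
  obtain ⟨ω, hω, hd⟩ := exists_wordDvd_of_mem_monomialIdeal h1 (w := u) (by simp)
  exact hn ω hω hd

/-- Reduction to normal form: modulo an ideal containing `G`, every word is a combination of normal
words that are not larger with respect to the weight. -/
theorem mono_mem_span_normal_sup (hlt : IsMonomialOrdering lt) {m : Fin n → ℕ}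
    (hdeg : ∀ u v, lt u v → wdeg m u ≤ wdeg m v) {I : TwoSidedIdeal (FreeAlg K n)}
    (hG : G ⊆ (I : Set (FreeAlg K n))) (p : ℕ) (v : Word n) (hv : wdeg m v ≤ p) :
    mono K v ∈ Submodule.span K (mono K '' {w | IsNormalWord (LM lt G) w ∧ wdeg m w ≤ p}) ⊔
      I.asIdeal.restrictScalars K := by
  have := hlt.wellOrder
  induction v using IsWellFounded.induction lt with
  | ind v ih =>
  by_cases hn : IsNormalWord (LM lt G) v
  · exact Submodule.mem_sup_left (Submodule.subset_span ⟨v, ⟨hn, hv⟩, rfl⟩)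
  simp only [IsNormalWord, not_forall, not_not] at hn
  obtain ⟨ω, ⟨g, hg, hgω⟩, a, b, rfl⟩ := hn
  have hf : IsLM lt (mono K a * g * mono K b) (a * ω * b) :=
    ((isLM_mono a).mul hlt hgω).mul hlt (isLM_mono b)
  have hfI : mono K a * g * mono K b ∈ I.asIdeal.restrictScalars K :=
    (TwoSidedIdeal.mem_asIdeal).2
      (TwoSidedIdeal.mul_mem_right _ _ _ (TwoSidedIdeal.mul_mem_left _ _ _ (hG hg)))
  rw [← sub_add_cancel (mono K (a * ω * b))
    (((mono K a * g * mono K b).coeff (a * ω * b))⁻¹ • (mono K a * g * mono K b))]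
  refine Submodule.add_mem _ ?_ (Submodule.mem_sup_right (Submodule.smul_mem _ _ hfI))
  refine Submodule.span_le.2 ?_ hf.mono_sub_smul_mem
  rintro _ ⟨w, hw, rfl⟩
  exact ih w hw ((hdeg _ _ hw).trans hv)

end FreeAlgebra

/-! ## The associated graded algebra of a quotient of the free algebra -/

section

variable {K : Type*} [Field K] {n : ℕ}

theorem freeFiltration_eq_span (m : Fin n → ℕ) (p : ℕ) :
    freeFiltration K m p = Submodule.span K (mono K '' {w | wdeg m w ≤ p}) := by
  refine le_antisymm (iSup₂_le fun q hq => Submodule.span_mono (Set.image_mono ?_))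
    (Submodule.span_le.2 ?_)
  · intro w (hw : wdeg m w = q)
    exact hw.trans_le hq
  · rintro _ ⟨w, hw, rfl⟩
    exact (le_iSup₂_of_le (f := fun q (_ : q ≤ p) => homPart K m q) (wdeg m w) hw le_rfl)
      (Submodule.subset_span ⟨w, rfl, rfl⟩)

theorem ltPart_quotFiltration_eq (m : Fin n → ℕ) (I : TwoSidedIdeal (FreeAlg K n)) (p : ℕ) :
    ltPart (quotFiltration m I) p =
      (Submodule.span K (mono K '' {w | wdeg m w < p})).map
        (Ideal.Quotient.mkₐ K I.asIdeal).toLinearMap := by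
  refine le_antisymm (iSup₂_le fun q hq => Submodule.map_mono ?_) ?_
  · rw [freeFiltration_eq_span]
    exact Submodule.span_mono (Set.image_mono fun w (hw : wdeg m w ≤ q) => hw.trans_lt hq)
  · rw [Submodule.map_le_iff_le_comap, Submodule.span_le]
    rintro _ ⟨w, hw, rfl⟩
    refine (le_iSup₂_of_le (f := fun q (_ : q < p) => quotFiltration m I q) (wdeg m w) hw le_rfl) ?_
    refine Submodule.mem_map_of_mem ?_
    rw [freeFiltration_eq_span]
    exact Submodule.subset_span ⟨w, le_refl (wdeg m w), rfl⟩

theorem homPart_pow_mem {m : Fin n → ℕ} {p : ℕ} {x : FreeAlg K n} (hx : x ∈ homPart K m p)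
    (k : ℕ) : x ^ k ∈ homPart K m (k * p) := by
  induction k with
  | zero =>
    rw [zero_mul, pow_zero]
    exact Submodule.subset_span ⟨1, rfl, map_one _⟩
  | succ k ih =>
    rw [pow_succ, Nat.succ_mul]
    exact homPart_mul_mem m _ _ _ _ ih hx

theorem homPart_le_freeFiltration (m : Fin n → ℕ) (p : ℕ) :
    homPart K m p ≤ freeFiltration K m p :=
  le_iSup₂_of_le (f := fun q (_ : q ≤ p) => homPart K m q) p le_rfl le_rfl

/-- The homogeneous element of `G(A)` given by a homogeneous element of the free algebra. -/
def homClass (m : Fin n → ℕ) (I : TwoSidedIdeal (FreeAlg K n)) {p : ℕ} (x : homPart K m p) :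
    GrPiece (quotFiltration m I) p :=
  grMk _ ⟨Ideal.Quotient.mk I.asIdeal x,
    Submodule.mem_map_of_mem (homPart_le_freeFiltration m p x.2)⟩

theorem of_homClass_mul (m : Fin n → ℕ) (I : TwoSidedIdeal (FreeAlg K n)) {p q : ℕ}
    (x : homPart K m p) (y : homPart K m q) :
    DirectSum.of (GrPiece (quotFiltration m I)) p (homClass m I x) *
        DirectSum.of (GrPiece (quotFiltration m I)) q (homClass m I y) =
      DirectSum.of (GrPiece (quotFiltration m I)) (p + q)
        (homClass m I ⟨x * y, homPart_mul_mem m p q _ _ x.2 y.2⟩) := by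
  rw [DirectSum.of_mul_of]
  refine DirectSum.of_eq_of_gradedMonoid_eq (gr_ext _ rfl _ _ ?_)
  exact (map_mul (Ideal.Quotient.mk I.asIdeal) _ _).symm

theorem of_homClass_pow (m : Fin n → ℕ) (I : TwoSidedIdeal (FreeAlg K n)) {p : ℕ}
    (x : homPart K m p) (k : ℕ) :
    DirectSum.of (GrPiece (quotFiltration m I)) p (homClass m I x) ^ k =
      DirectSum.of (GrPiece (quotFiltration m I)) (k * p)
        (homClass m I ⟨x ^ k, homPart_pow_mem x.2 k⟩) := by
  induction k with
  | zero =>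
    rw [pow_zero]
    refine DirectSum.of_eq_of_gradedMonoid_eq (gr_ext _ (zero_mul p).symm _ _ ?_)
    simp
  | succ k ih =>
    rw [pow_succ, ih, of_homClass_mul]
    refine DirectSum.of_eq_of_gradedMonoid_eq (gr_ext _ (Nat.succ_mul k p).symm _ _ ?_)
    simp [pow_succ]

/-- A homogeneous element of the free algebra whose leading monomial is normal has nonzero class in
the associated graded algebra. -/
theorem homClass_ne_zero {lt : Word n → Word n → Prop} {m : Fin n → ℕ}
    (hlt : ∀ u v, wdeg m u < wdeg m v → lt u v) {G : Set (FreeAlg K n)}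
    {I : TwoSidedIdeal (FreeAlg K n)} (hG : IsGroebnerBasis lt G I) {p : ℕ} (x : homPart K m p)
    {u : Word n} (hu : IsLM lt (x : FreeAlg K n) u) (hn : IsNormalWord (LM lt G) u) :
    homClass m I x ≠ 0 := by
  classical
  intro h
  rw [← grMk_zero, homClass, grMk_eq_iff, Submodule.coe_zero, sub_zero,
    ltPart_quotFiltration_eq] at h
  obtain ⟨e, he, hxe⟩ := h
  have hup : wdeg m u = p := mem_span_mono.1 x.2 u hu.1
  have he' := mem_span_mono.1 he
  -- Since `e` has degree below `p`, subtracting it leaves the leading monomial `u` unchanged, and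
  -- the Gröbner property forbids a normal one in `I`.
  have hI : (x : FreeAlg K n) - e ∈ I := by
    rw [← TwoSidedIdeal.mem_asIdeal, ← Ideal.Quotient.mk_eq_mk_iff_sub_mem]
    exact hxe.symm
  refine hG.not_isNormalWord hI (u := u) ⟨?_, fun v hv hvu => ?_⟩ hn
  · have : e.coeff u = 0 := by
      by_contra h
      exact absurd (he' u h) (by simp [hup])
    simpa [this] using hu.1
  · by_cases hv0 : (x : FreeAlg K n).coeff v = 0
    · refine hlt v u (hup ▸ he' v fun h => hv ?_)
      simp [hv0, h]
    · exact hu.2 v hv0 hvu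

/-- A nonzero homogeneous element of `G(A)` is the class of a homogeneous combination of normal
words. -/
theorem exists_homClass_eq {lt : Word n → Word n → Prop} (hord : IsMonomialOrdering lt)
    {m : Fin n → ℕ} (hdeg : ∀ u v, lt u v → wdeg m u ≤ wdeg m v) {G : Set (FreeAlg K n)}
    {I : TwoSidedIdeal (FreeAlg K n)} (hG : G ⊆ (I : Set (FreeAlg K n))) {p : ℕ}
    (y : GrPiece (quotFiltration m I) p) :
    ∃ x : homPart K m p, homClass m I x = y ∧
      ∀ w, (x : FreeAlg K n).coeff w ≠ 0 → IsNormalWord (LM lt G) w := by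
  obtain ⟨⟨_, f, hf, rfl⟩, rfl⟩ := grMk_surjective _ y
  have hf' : f ∈ Submodule.span K (mono K '' {w | IsNormalWord (LM lt G) w ∧ wdeg m w ≤ p}) ⊔
      I.asIdeal.restrictScalars K := by
    rw [freeFiltration_eq_span] at hf
    refine Submodule.span_le.2 ?_ hf
    rintro _ ⟨w, hw, rfl⟩
    exact mono_mem_span_normal_sup hord hdeg hG p w hw
  obtain ⟨t, ht, i, hi, rfl⟩ := Submodule.mem_sup.1 hf'
  -- The part of the normal form in degree below `p` vanishes in G(A)_p, so only its top part is
  -- kept.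
  have hsplit : {w | IsNormalWord (LM lt G) w ∧ wdeg m w ≤ p} ⊆
      {w | IsNormalWord (LM lt G) w ∧ wdeg m w = p} ∪ {w | wdeg m w < p} := by
    rintro w ⟨h1, h2⟩
    rcases h2.eq_or_lt with h | h
    · exact Or.inl ⟨h1, h⟩
    · exact Or.inr h
  have ht' := Submodule.span_mono (Set.image_mono hsplit) ht
  rw [Set.image_union, Submodule.span_union] at ht'
  obtain ⟨g, hg, e, he, rfl⟩ := Submodule.mem_sup.1 ht'
  refine ⟨⟨g, Submodule.span_mono (Set.image_mono fun w hw => hw.2) hg⟩, ?_,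
    fun w hw => (mem_span_mono.1 hg w hw).1⟩
  rw [homClass, grMk_eq_iff, ltPart_quotFiltration_eq]
  refine ⟨-e, Submodule.neg_mem _ he, ?_⟩
  have hi0 : Ideal.Quotient.mk I.asIdeal i = 0 := Ideal.Quotient.eq_zero_iff_mem.2 hi
  change Ideal.Quotient.mk I.asIdeal (-e) =
    Ideal.Quotient.mk I.asIdeal g - Ideal.Quotient.mk I.asIdeal (g + e + i)
  rw [map_add, map_add, hi0, map_neg]
  abel

theorem length_pos_of_wdeg_pos {m : Fin n → ℕ} {u : Word n} (h : 0 < wdeg m u) :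
    1 ≤ u.length := by
  refine Nat.one_le_iff_ne_zero.2 fun h0 => ?_
  rw [FreeMonoid.length_eq_zero.1 h0] at h
  simp [wdeg] at h

theorem eq_one_of_wdeg_eq_zero {m : Fin n → ℕ} (hm : ∀ i, 0 < m i) {u : Word n}
    (h : wdeg m u = 0) : u = 1 := by
  induction u using FreeMonoid.casesOn with
  | one => rfl
  | of_mul i v =>
    rw [wdeg_mul] at h
    have := hm i
    simp [wdeg] at h
    omega

/-- Every homogeneous element of degree zero is the class of a constant. -/
theorem exists_smul_one_eq {m : Fin n → ℕ} (hm : ∀ i, 0 < m i)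
    {I : TwoSidedIdeal (FreeAlg K n)} (y : GrPiece (quotFiltration m I) 0) :
    ∃ c : K, c • grMk (quotFiltration m I) ⟨1, SetLike.GradedOne.one_mem⟩ = y := by
  obtain ⟨⟨_, f, hf, rfl⟩, rfl⟩ := grMk_surjective _ y
  have hset : {w : Word n | wdeg m w ≤ 0} = {1} := by
    ext w
    simp only [Nat.le_zero, Set.mem_ofPred_eq, Set.mem_singleton_iff]
    exact ⟨eq_one_of_wdeg_eq_zero hm, fun h => by simp [h, wdeg]⟩
  rw [freeFiltration_eq_span, hset, Set.image_singleton] at hf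
  obtain ⟨c, rfl⟩ := Submodule.mem_span_singleton.1 hf
  refine ⟨c, ?_⟩
  change grMk _ (c • _) = _
  refine congrArg _ (Subtype.ext ?_)
  change c • (1 : QuotAlg I) = Ideal.Quotient.mkₐ K I.asIdeal (c • mono K 1)
  rw [map_smul, mono, map_one, map_one]

/-- A prime above the characteristic is invertible in `K`. This makes the averaging argument valid
over every field. -/
theorem exists_prime_gt_torsion_free (K M : Type*) [Field K] [AddCommGroup M] [Module K M]
    (N : ℕ) : ∃ q > N, q.Prime ∧ ∀ r : M, q • r = 0 → r = 0 := by
  obtain ⟨q, hq, hp⟩ := Nat.exists_infinite_primes (max N (ringChar K) + 1)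
  refine ⟨q, by omega, hp, fun r hr => ?_⟩
  have hqK : (q : K) ≠ 0 := by
    intro h0
    have hdvd : ringChar K ∣ q := ringChar.dvd h0
    rcases (Nat.dvd_prime hp).1 hdvd with h | h
    · exact CharP.ringChar_ne_one h
    · omega
  rw [← Nat.cast_smul_eq_nsmul K] at hr
  exact (smul_eq_zero.1 hr).resolve_left hqK

/-- The Jacobson radical of `G(A)` contains no nonzero homogeneous element of degree zero. -/
theorem component_zero_eq_zero_of_mem_jacobson {m : Fin n → ℕ} (hm : ∀ i, 0 < m i)
    {I : TwoSidedIdeal (FreeAlg K n)} {y : GrPiece (quotFiltration m I) 0}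
    (hy : DirectSum.of (GrPiece (quotFiltration m I)) 0 y ∈
      Ring.jacobson (AssocGraded (quotFiltration m I))) : y = 0 := by
  obtain ⟨c, rfl⟩ := exists_smul_one_eq hm y
  by_cases hc : c = 0
  · rw [hc, zero_smul]
  set e := grMk (quotFiltration m I) ⟨1, SetLike.GradedOne.one_mem⟩ with he
  have hone : DirectSum.of (GrPiece (quotFiltration m I)) 0 e = 1 := rfl
  have hmul : DirectSum.of (GrPiece (quotFiltration m I)) 0 (c⁻¹ • e) *
      DirectSum.of (GrPiece (quotFiltration m I)) 0 (c • e) = 1 := by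
    rw [DirectSum.of_mul_of, ← hone]
    refine DirectSum.of_eq_of_gradedMonoid_eq (gr_ext _ (add_zero 0) _ _ ?_)
    simp [hc]
  have h1 := Ideal.mul_mem_left _ (DirectSum.of (GrPiece (quotFiltration m I)) 0 (c⁻¹ • e)) hy
  rw [hmul] at h1
  obtain ⟨h, hh⟩ := exists_mul_one_sub_eq_one h1
  -- Now 0 = 1 in G(A), so `y` vanishes in any case; G(A) need not be nontrivial.
  rw [sub_self, mul_zero] at hh
  refine DirectSum.of_injective 0 ?_
  rw [map_zero, ← mul_one (DirectSum.of _ 0 (c • e)), ← hh, mul_zero]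

end

end GradedGroebner

end
-- Semiprimitivity of the associated graded algebra
open GradedGroebner

theorem theorem3p3 {K : Type*} [Field K] (n : ℕ) (m : Fin n → ℕ) (hm : ∀ i, 0 < m i)
    (ltgr : Word n → Word n → Prop) (hlt : IsGradedMonomialOrdering m ltgr)
    (G : Set (FreeAlg K n)) (hfin : G.Finite)
    (hG : IsGroebnerBasis ltgr G (TwoSidedIdeal.span G))
    (hX : ∀ i : Fin n, FreeMonoid.of i ∉ LM ltgr G)
    (hred : IsReduced (LM ltgr G))
    (hsp : IsSemiprimeRing (QuotAlg (monomialIdeal K (LM ltgr G)))) :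
    IsSemiprimitiveRing (AssocGraded (quotFiltration m (TwoSidedIdeal.span G))) := by
  classical
  obtain ⟨hord, lt, -, hgr⟩ := hlt
  have hdeg : ∀ u v, ltgr u v → wdeg m u ≤ wdeg m v := by
    intro u v h
    rw [hgr] at h
    exact h.elim le_of_lt fun h => h.1.le
  have hdeg' : ∀ u v, wdeg m u < wdeg m v → ltgr u v := by
    intro u v h
    rw [hgr]
    exact Or.inl h
  obtain ⟨N, hN⟩ : ∃ N, ∀ ω ∈ LM ltgr G, ω.length ≤ N := by
    have hsub : LM ltgr G ⊆ ⋃ g ∈ G, (g.coeff.support : Set (Word n)) := by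
      rintro ω ⟨g, hg, hω⟩
      exact Set.mem_biUnion hg (Finset.mem_coe.2 (Finsupp.mem_support_iff.2 hω.1))
    have hLM : (LM ltgr G).Finite :=
      (hfin.biUnion fun g _ => g.coeff.support.finite_toSet).subset hsub
    obtain ⟨N, hN⟩ := (hLM.image FreeMonoid.length).bddAbove
    exact ⟨N, fun ω hω => hN ⟨ω, hω, rfl⟩⟩
  set I := TwoSidedIdeal.span G with hI
  rw [IsSemiprimitiveRing, eq_bot_iff]
  intro f hf
  have hpos : ∀ j, 0 < j → f j = 0 := by
    intro j hj
    by_contra hfj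
    obtain ⟨x, hx, hxn⟩ := exists_homClass_eq hord hdeg (fun g hg => (hG.1 hg).1) (f j)
    have hx0 : (x : FreeAlg K n) ≠ 0 := by
      intro h0
      refine hfj ?_
      rw [← hx, show x = 0 from Subtype.ext h0, homClass, ← grMk_zero]
      exact congrArg _ (Subtype.ext (map_zero _))
    obtain ⟨u, hu⟩ := exists_isLM hord hx0
    have huj : wdeg m u = j := mem_span_mono.1 x.2 u hu.1
    obtain ⟨w, hw⟩ := (hxn u hu.1).exists_pow_normal hN
      (fun v hv => exists_normal_mul_mul_of_semiprime hsp hv)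
      (length_pos_of_wdeg_pos (m := m) (by omega))
    let y : homPart K m (wdeg m w) := ⟨mono K w, Submodule.subset_span ⟨w, rfl, rfl⟩⟩
    -- The factor `w` is essential: `u` alone may have a non-normal power, so non-nilpotence is only
    -- guaranteed for the product with `w`.
    obtain ⟨k, hk⟩ := isNilpotent_component_mul hf (exists_prime_gt_torsion_free K _)
      (show 0 < j + wdeg m w by omega) (homClass m I y)
    rw [← hx, of_homClass_mul, of_homClass_pow] at hk
    have hz := DirectSum.of_injective _ (hk.trans (map_zero _).symm)
    exact homClass_ne_zero hdeg' hG _ ((hu.mul hord (isLM_mono w)).pow hord k) (hw k) hz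
  have hf0 : f = DirectSum.of _ 0 (f 0) := by
    refine DFinsupp.ext fun j => ?_
    rcases Nat.eq_zero_or_pos j with rfl | hj
    · exact (DirectSum.of_eq_same 0 (f 0)).symm
    · rw [hpos j hj]
      exact (DirectSum.of_eq_of_ne 0 j (f 0) hj.ne').symm
  rw [hf0] at hf
  rw [hf0, component_zero_eq_zero_of_mem_jacobson hm hf, map_zero]
  exact Submodule.zero_mem _
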